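/- For positive integers $q,a$ let $c_q(a)=\sum_{1\le h\le q,\ \gcd(h,q)=1}e^{2\pi i a h/q}$ be the Ramanujan sum. A multiplicative function $G:\mathbb N\to\mathbb C$ (here $\mathbb N=\{1,2,3,\dots\}$; $G(1)=1$ and $G(mn)=G(m)G(n)$ whenever $\gcd(m,n)=1$) is called exotic if there is a prime $p$ with $G(p^K)=1$ for all integers $K\ge 0$. (1) Let $p_0$ be a prime and let $G_0:\mathbb N\to\mathbb C$ be a multiplicative function such that $G_0(p_0^k)=1$ for all $k\in\mathbb N$ and $G_0(p)=1/p$ for every prime $p\ne p_0$ (the values of $G_0$ at higher powers of the primes $p\neq p_0$ are arbitrary). Then $G_0$ is exotic, and for every $a\in\mathbb N$ the series $\sum_{q=1}^{\infty}G_0(q)c_q(a)$ converges to $0$ (that is, $\lim_{Q\to\infty}\sum_{q\le Q}G_0(q)c_q(a)=0$) but does not converge absolutely (that is, $\sum_{q=1}^{\infty}|G_0(q)c_q(a)|=\infty$). (2) Consequently, exotic coefficients need not give absolutely convergent expansions: there exists an exotic $G$ such that, for every $a\in\mathbb N$, $\sum_{q=1}^{\infty}G(q)c_q(a)$ converges to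 $0$ but not absolutely. -/

import Mathlib

open Filter Topology

noncomputable section

/-- The Ramanujan sum `c_q(a)`: the sum of the `a`-th powers of the primitive `q`-th roots of
unity `exp (2πi h / q)`, with `1 ≤ h ≤ q` and `gcd(h, q) = 1` (so that `c_1(a) = 1`). -/
def ramanujanSum (q a : ℕ) : ℂ :=
  ∑ h ∈ (Finset.Icc 1 q).filter (fun h => Nat.Coprime h q),
    Complex.exp (2 * (Real.pi : ℂ) * Complex.I * (a : ℂ) * (h : ℂ) / (q : ℂ))

/-- The series `∑_{q ≥ 1} G(q) c_q(a)` converges to `L`, as the limit of its partial sums. -/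
def RamanujanSeriesTendsto (G : ArithmeticFunction ℂ) (a : ℕ) (L : ℂ) : Prop :=
  Tendsto (fun Q : ℕ => ∑ q ∈ Finset.Icc 1 Q, G q * ramanujanSum q a) atTop (𝓝 L)

/-- The series `∑_{q ≥ 1} G(q) c_q(a)` converges absolutely. (The term at `q = 0` vanishes, since
`G 0 = 0` for an `ArithmeticFunction`.) -/
def RamanujanSeriesAbsConv (G : ArithmeticFunction ℂ) (a : ℕ) : Prop :=
  Summable (fun q : ℕ => ‖G q * ramanujanSum q a‖)

/-- The Ramanujan cloud `⟨F⟩` of `F`: the arithmetic functions `G` with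
`∑_{q ≥ 1} G(q) c_q(a) = F(a)` (pointwise convergence) for every positive integer `a`. -/
def ramanujanCloud (F : ArithmeticFunction ℂ) : Set (ArithmeticFunction ℂ) :=
  {G | ∀ a : ℕ, 1 ≤ a → RamanujanSeriesTendsto G a (F a)}

/-- A multiplicative `G` is exotic iff there is a prime `p` with `G(p^K) = 1` for all `K ≥ 0`. -/
def IsExotic (G : ArithmeticFunction ℂ) : Prop :=
  G.IsMultiplicative ∧ ∃ p : ℕ, p.Prime ∧ ∀ K : ℕ, G (p ^ K) = 1

end

/-! For fixed `a`, the term `f(q) = G(q) c_q(a)` is multiplicative. At a prime `p ∤ a p₀` one has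
`c_{p^k}(a) = μ(p^k)`, so `f(p) = -1/p` and `f` vanishes at higher powers; at `p ∣ a p₀`, `f(p^k) =
0` once `p^k ∤ a p`. Hence `f` is the convolution of a function supported on finitely many divisors
with `μ(n)/n` restricted to `n` coprime to `a p₀` (`eq_restrictDvd_mul_coprimeMoebiusDiv`). The
partial sums of the second factor tend to `0`, which is the prime number theorem in Möbius form, and
a finite convolution preserves this. Absolute convergence fails because `∑ 1/p` diverges.

The analytic input `∑ χ₀(n) μ(n)/n = 0` comes from a Tauberian argument: the sum up to `e^u` has
Laplace transform `1/(s L(1+s, χ₀))`, which is continuous on `Re s ≥ 0` by nonvanishing of `L` on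
the line `Re = 1`. -/

/-! ### A Tauberian theorem for Laplace transforms. -/

open MeasureTheory FourierTransform SchwartzMap in
/-- Fourier inversion under the Laplace transform: pairing with a translated Fourier transform. -/
theorem integral_mul_exp_mul_fourier_sub {m : ℝ → ℂ} {H : ℂ → ℂ} (k : 𝓢(ℝ, ℂ)) {ε : ℝ}
    (hint : Integrable fun u : ℝ => m u * Complex.exp (-(ε : ℂ) * u))
    (hL : ∀ t : ℝ, ∫ u : ℝ, m u * Complex.exp (-(ε + 2 * Real.pi * t * Complex.I) * u)
      = H (ε + 2 * Real.pi * t * Complex.I)) (v : ℝ) :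
    ∫ u : ℝ, m u * Complex.exp (-(ε : ℂ) * u) * 𝓕 (k : ℝ → ℂ) (u - v) =
      ∫ t : ℝ, H (ε + 2 * Real.pi * t * Complex.I) *
        (Complex.exp (2 * Real.pi * t * v * Complex.I) * k t) := by
  have hg : Integrable fun t : ℝ => Complex.exp (2 * Real.pi * t * v * Complex.I) * k t := by
    refine (k.integrable (μ := volume)).bdd_mul (c := 1) (by fun_prop) (ae_of_all _ fun t => ?_)
    rw [show (2 * Real.pi * t * v * Complex.I : ℂ) = ((2 * Real.pi * t * v : ℝ) : ℂ) * Complex.I by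
      push_cast; ring, Complex.norm_exp_ofReal_mul_I]
  have key := VectorFourier.integral_fourierIntegral_smul_eq_flip (L := innerₗ ℝ)
    Real.continuous_fourierChar continuous_inner hint hg
  rw [flip_innerₗ] at key
  have e1 : ∀ t : ℝ, VectorFourier.fourierIntegral Real.fourierChar volume (innerₗ ℝ)
      (fun u : ℝ => m u * Complex.exp (-(ε : ℂ) * u)) t
      = H (ε + 2 * Real.pi * t * Complex.I) := by
    intro t
    rw [← hL]
    change 𝓕 (fun u : ℝ => m u * Complex.exp (-(ε : ℂ) * u)) t = _
    rw [Real.fourier_eq']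
    refine integral_congr_ae (ae_of_all _ fun u => ?_)
    simp only [smul_eq_mul, RCLike.inner_apply, conj_trivial]
    rw [mul_left_comm, ← Complex.exp_add]
    congr 2
    push_cast; ring
  have e2 : ∀ u : ℝ, VectorFourier.fourierIntegral Real.fourierChar volume (innerₗ ℝ)
      (fun t : ℝ => Complex.exp (2 * Real.pi * t * v * Complex.I) * k t) u
      = 𝓕 (k : ℝ → ℂ) (u - v) := by
    intro u
    change 𝓕 (fun t : ℝ => Complex.exp (2 * Real.pi * t * v * Complex.I) * k t) u = _
    rw [Real.fourier_eq', Real.fourier_eq']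
    refine integral_congr_ae (ae_of_all _ fun t => ?_)
    simp only [smul_eq_mul, RCLike.inner_apply, conj_trivial]
    rw [← mul_assoc, ← Complex.exp_add]
    congr 2
    push_cast; ring
  simp only [e1, e2, smul_eq_mul] at key
  exact key.symm

open MeasureTheory in
theorem integrable_mul_exp_of_linear_growth {m : ℝ → ℂ} {C : ℝ} (hm : Measurable m)
    (hzero : ∀ u < 0, m u = 0) (hbd : ∀ u, ‖m u‖ ≤ C * (1 + |u|)) {s : ℂ} (hs : 0 < s.re) :
    Integrable fun u : ℝ => m u * Complex.exp (-s * u) := by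
  have hI : IntegrableOn (fun u : ℝ => C * (Real.exp (-s.re * u) + u * Real.exp (-s.re * u)))
      (Set.Ioi 0) := by
    refine Integrable.const_mul (Integrable.add (integrableOn_exp_mul_Ioi (by simpa) 0) ?_) C
    change IntegrableOn (fun u : ℝ => u * Real.exp (-s.re * u)) (Set.Ioi 0)
    simpa using integrableOn_rpow_mul_exp_neg_mul_rpow (s := 1) (p := 1) (by norm_num) one_pos hs
  rw [← integrableOn_Ici_iff_integrableOn_Ioi] at hI
  rw [← integrableOn_iff_integrable_of_support_subset (s := Set.Ici (0 : ℝ))]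
  · refine hI.mono' (by fun_prop) ?_
    refine (ae_restrict_iff' measurableSet_Ici).mpr (ae_of_all _ fun u hu => ?_)
    rw [norm_mul, Complex.norm_exp]
    have := hbd u
    rw [abs_of_nonneg hu] at this
    calc _ ≤ C * (1 + u) * Real.exp (-s.re * u) := by
          simpa using mul_le_mul_of_nonneg_right this (Real.exp_nonneg _)
      _ = _ := by ring
  · intro u hu
    by_contra h
    simp [hzero u (not_le.mp h)] at hu

-- Supplies the dominating function for removing the damping factor `exp (-ε u)`.
open MeasureTheory FourierTransform SchwartzMap in
theorem integrable_mul_norm_shift {C : ℝ} (K : 𝓢(ℝ, ℂ)) (v : ℝ) :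
    Integrable fun u : ℝ => C * (1 + |u|) * ‖K (u - v)‖ := by
  have h1 : Integrable fun w : ℝ => ‖K w‖ := K.integrable.norm
  have h2 : Integrable fun w : ℝ => |w| * ‖K w‖ := by
    simpa using K.integrable_pow_mul volume 1
  have h3 : Integrable fun w : ℝ => |C| * ((1 + |v|) * ‖K w‖ + |w| * ‖K w‖) :=
    ((h1.const_mul _).add h2).const_mul _
  refine (h3.comp_sub_right v).mono' ?_ (ae_of_all _ fun u => ?_)
  · exact Continuous.aestronglyMeasurable (by have := K.continuous; fun_prop)
  · rw [norm_mul, norm_mul, norm_norm, ← add_mul, mul_assoc, Real.norm_eq_abs C]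
    have : ‖1 + |u|‖ ≤ 1 + |v| + |u - v| := by
      rw [Real.norm_of_nonneg (by positivity)]
      have := abs_add_le v (u - v)
      rw [add_sub_cancel] at this
      linarith
    gcongr

open MeasureTheory FourierTransform SchwartzMap in
/-- If the Laplace transform of `m` extends continuously to the closed half plane, then the
convolutions of `m` with band-limited Schwartz kernels tend to zero. -/
theorem tendsto_integral_mul_fourier_of_laplace {m : ℝ → ℂ} {C : ℝ} {H : ℂ → ℂ} (hm : Measurable m)
    (hzero : ∀ u < 0, m u = 0) (hbd : ∀ u, ‖m u‖ ≤ C * (1 + |u|))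
    (hH : ContinuousOn H {s | 0 ≤ s.re})
    (hL : ∀ s : ℂ, 0 < s.re → ∫ u : ℝ, m u * Complex.exp (-s * u) = H s)
    (k : 𝓢(ℝ, ℂ)) (hk : HasCompactSupport k) :
    Tendsto (fun v : ℝ => ∫ w : ℝ, m (v + w) * 𝓕 (k : ℝ → ℂ) w) atTop (𝓝 0) := by
  have hshift : ∀ v : ℝ, ∫ w : ℝ, m (v + w) * 𝓕 (k : ℝ → ℂ) w =
      ∫ u : ℝ, m u * 𝓕 (k : ℝ → ℂ) (u - v) := by
    intro v
    rw [← integral_sub_right_eq_self (fun w : ℝ => m (v + w) * 𝓕 (k : ℝ → ℂ) w) v]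
    simp
  have hK : ∀ u, 𝓕 (k : ℝ → ℂ) u = (𝓕 k : 𝓢(ℝ, ℂ)) u := fun u => rfl
  have hnexp : ∀ t v : ℝ, ‖Complex.exp (2 * Real.pi * t * v * Complex.I)‖ = 1 := by
    intro t v
    rw [show (2 * Real.pi * t * v * Complex.I : ℂ) = ((2 * Real.pi * t * v : ℝ) : ℂ) * Complex.I by
      push_cast; ring, Complex.norm_exp_ofReal_mul_I]
  -- Let `ε → 0⁺` in the damped inversion identity, by dominated convergence on both sides.
  have hboundary : ∀ v : ℝ, ∫ u : ℝ, m u * 𝓕 (k : ℝ → ℂ) (u - v) =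
      ∫ t : ℝ, H (2 * Real.pi * t * Complex.I) *
        (Complex.exp (2 * Real.pi * t * v * Complex.I) * k t) := by
    intro v
    have hl : Tendsto (fun ε : ℝ => ∫ u : ℝ, m u * Complex.exp (-(ε : ℂ) * u) *
        𝓕 (k : ℝ → ℂ) (u - v)) (𝓝[>] 0) (𝓝 (∫ u : ℝ, m u * 𝓕 (k : ℝ → ℂ) (u - v))) := by
      refine tendsto_integral_filter_of_dominated_convergence _ ?_ ?_
        (integrable_mul_norm_shift (C := C) (𝓕 k) v) ?_
      · refine Eventually.of_forall fun ε => Measurable.aestronglyMeasurable ?_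
        have : Continuous fun u => 𝓕 (k : ℝ → ℂ) (u - v) := by
          simp only [hK]
          have := (𝓕 k : 𝓢(ℝ, ℂ)).continuous
          fun_prop
        have := this.measurable
        exact (by fun_prop : Measurable fun u : ℝ => m u * Complex.exp (-(ε : ℂ) * u)).mul this
      · filter_upwards [self_mem_nhdsWithin] with ε hε
        refine ae_of_all _ fun u => ?_
        rw [norm_mul, norm_mul, hK]
        refine mul_le_mul_of_nonneg_right ?_ (norm_nonneg _)
        rcases lt_or_ge u 0 with hu | hu
        · simpa [hzero u hu] using (norm_nonneg _).trans (hbd u)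
        · refine (mul_le_of_le_one_right (norm_nonneg _) ?_).trans (hbd u)
          rw [Complex.norm_exp]
          simpa using mul_nonneg (le_of_lt hε) hu
      · refine ae_of_all _ fun u => ?_
        have hc : Continuous fun ε : ℝ => m u * Complex.exp (-(ε : ℂ) * u) *
          𝓕 (k : ℝ → ℂ) (u - v) := by fun_prop
        have := hc.tendsto 0
        simp only [Complex.ofReal_zero, neg_zero, zero_mul, Complex.exp_zero, mul_one] at this
        exact this.mono_left nhdsWithin_le_nhds
    have hr : Tendsto (fun ε : ℝ => ∫ t : ℝ, H (ε + 2 * Real.pi * t * Complex.I) *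
        (Complex.exp (2 * Real.pi * t * v * Complex.I) * k t)) (𝓝[>] 0)
        (𝓝 (∫ t : ℝ, H (2 * Real.pi * t * Complex.I) *
        (Complex.exp (2 * Real.pi * t * v * Complex.I) * k t))) := by
      -- Compact support of `k` confines `H` to a compact rectangle, where continuity up to the
      -- boundary bounds it.
      have hcomp : IsCompact ((fun p : ℝ × ℝ => (p.1 + 2 * Real.pi * p.2 * Complex.I : ℂ)) ''
          (Set.Icc 0 1 ×ˢ tsupport k)) :=
        (isCompact_Icc.prod hk).image (by fun_prop)
      obtain ⟨B, hB⟩ := hcomp.exists_bound_of_continuousOn (f := H) (hH.mono (by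
        rintro _ ⟨p, hp, rfl⟩
        simpa using hp.1.1))
      have hcont : ∀ ε : ℝ, 0 ≤ ε → Continuous fun t : ℝ => H (ε + 2 * Real.pi * t * Complex.I) := by
        intro ε hε
        exact hH.comp_continuous (by fun_prop) fun t => by simpa using hε
      refine tendsto_integral_filter_of_dominated_convergence (fun t => B * ‖k t‖) ?_ ?_
        (k.integrable.norm.const_mul _) ?_
      · filter_upwards [self_mem_nhdsWithin] with ε hε
        have h1 := hcont ε (le_of_lt hε)
        have h2 := k.continuous
        exact (h1.mul (.mul (by fun_prop) h2)).aestronglyMeasurable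
      · filter_upwards [Ioc_mem_nhdsGT (zero_lt_one (α := ℝ))] with ε hε
        refine ae_of_all _ fun t => ?_
        rw [norm_mul, norm_mul, hnexp, one_mul]
        by_cases ht : k t = 0
        · simp [ht]
        · gcongr
          exact hB _ ⟨(ε, t), ⟨⟨hε.1.le, hε.2⟩, subset_tsupport _ ht⟩, rfl⟩
      · refine ae_of_all _ fun t => Tendsto.mul_const _ ?_
        have hc : ContinuousOn (fun ε : ℝ => H (ε + 2 * Real.pi * t * Complex.I)) (Set.Ici 0) :=
          hH.comp (by fun_prop) fun ε hε => by simpa using hε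
        have := (hc 0 Set.self_mem_Ici).mono_left
          (nhdsWithin_mono _ (Set.Ioi_subset_Ici_self (a := (0 : ℝ))))
        simpa using this
    refine tendsto_nhds_unique (hl.congr' ?_) hr
    filter_upwards [self_mem_nhdsWithin] with ε hε
    refine integral_mul_exp_mul_fourier_sub k
      (integrable_mul_exp_of_linear_growth hm hzero hbd (by simpa using hε)) (fun t => ?_) v
    exact hL _ (by simpa using hε)
  simp only [hshift, hboundary]
  -- Riemann–Lebesgue on the boundary line; the sign convention of the character calls for frequency
  -- `-v`.
  have hRL := (Real.tendsto_integral_exp_smul_cocompact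
    fun t : ℝ => H (2 * Real.pi * t * Complex.I) * k t).comp
    ((tendsto_neg_atTop_atBot (G := ℝ)).mono_right atBot_le_cocompact)
  refine hRL.congr fun v => integral_congr_ae (ae_of_all _ fun t => ?_)
  simp only [Circle.smul_def, Real.fourierChar_apply, smul_eq_mul]
  rw [mul_left_comm]
  congr 3
  push_cast; ring_nf

-- By Fourier inversion at `0`, the normalisation `k 0 = 1` gives the band-limited kernel `𝓕 k`
-- total mass one.
open SchwartzMap in
theorem exists_schwartzMap_hasCompactSupport_apply_zero_eq_one :
    ∃ k : 𝓢(ℝ, ℂ), HasCompactSupport k ∧ k 0 = 1 := by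
  let b : ContDiffBump (0 : ℝ) := ⟨1, 2, by norm_num, by norm_num⟩
  have hs : HasCompactSupport fun x : ℝ => ((b x : ℝ) : ℂ) :=
    b.hasCompactSupport.comp_left Complex.ofReal_zero
  refine ⟨hs.toSchwartzMap (Complex.ofRealCLM.contDiff.comp b.contDiff), hs, ?_⟩
  have : b 0 = 1 := b.one_of_mem_closedBall (by simp [b.rIn_pos.le])
  change ((b 0 : ℝ) : ℂ) = 1
  simp [this]

open MeasureTheory FourierTransform SchwartzMap in
theorem integral_fourier_eq_apply_zero (k : 𝓢(ℝ, ℂ)) : ∫ w : ℝ, 𝓕 (k : ℝ → ℂ) w = k 0 := by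
  have h : 𝓕⁻ (𝓕 (k : ℝ → ℂ)) 0 = k 0 :=
    congrFun (k.continuous.fourierInv_fourier_eq k.integrable (𝓕 k : 𝓢(ℝ, ℂ)).integrable) 0
  rw [← h, Real.fourierInv_eq']
  simp

open MeasureTheory FourierTransform SchwartzMap in
/-- A slowly varying function whose Laplace transform extends continuously to the closed half
plane tends to zero. -/
theorem tendsto_zero_of_slowlyVarying_of_laplace {m : ℝ → ℂ} {H : ℂ → ℂ} (hm : Measurable m)
    (hzero : ∀ u < 0, m u = 0) (hlip : ∀ u v, ‖m u - m v‖ ≤ 1 + |u - v|)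
    (hslow : ∀ w : ℝ, ∀ δ > 0, ∀ᶠ v in atTop, ‖m (v + w) - m v‖ ≤ |w| + δ)
    (hH : ContinuousOn H {s | 0 ≤ s.re})
    (hL : ∀ s : ℂ, 0 < s.re → ∫ u : ℝ, m u * Complex.exp (-s * u) = H s) :
    Tendsto m atTop (𝓝 0) := by
  obtain ⟨k, hk, hk0⟩ := exists_schwartzMap_hasCompactSupport_apply_zero_eq_one
  obtain ⟨K, hK⟩ : ∃ K : 𝓢(ℝ, ℂ), ∀ w, 𝓕 (k : ℝ → ℂ) w = K w := ⟨𝓕 k, fun _ => rfl⟩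
  have hK1 : ∫ w : ℝ, K w = 1 := by
    rw [← hk0, ← integral_fourier_eq_apply_zero k]
    simp only [hK]
  have hKm : Integrable fun w : ℝ => |w| * ‖K w‖ := by
    simpa using K.integrable_pow_mul volume 1
  have hKn : Integrable fun w : ℝ => ‖K w‖ := K.integrable.norm
  set J := ∫ w : ℝ, |w| * ‖K w‖
  have hJ : 0 ≤ J := integral_nonneg fun w => by positivity
  have hbd : ∀ u, ‖m u‖ ≤ 2 + |u| := by
    intro u
    have h1 := hlip u (-1)
    rw [hzero (-1) (by norm_num), sub_zero] at h1
    have h2 := abs_sub u (-1)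
    rw [abs_neg, abs_one] at h2
    linarith
  have hconv : ∀ η : ℝ, 0 < η → Tendsto (fun v : ℝ => ∫ w : ℝ, m (v + η * w) * K w)
      atTop (𝓝 0) := by
    intro η hη
    -- Concentrating the kernel at scale `η` amounts to dilating `m`, whose Laplace transform
    -- becomes `η⁻¹ H(s/η)`.
    have := tendsto_integral_mul_fourier_of_laplace (m := fun u => m (η * u)) (C := 2 + η)
      (H := fun s => (η : ℂ)⁻¹ * H (s / η)) (by fun_prop)
      (fun u hu => hzero _ (mul_neg_of_pos_of_neg hη hu)) (fun u => ?_) ?_ (fun s hs => ?_) k hk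
    · refine (this.comp (tendsto_id.atTop_div_const hη)).congr fun v => ?_
      simp only [Function.comp, id, hK, mul_add, mul_div_cancel₀ v hη.ne']
    · refine (hbd _).trans ?_
      rw [abs_mul, abs_of_pos hη]
      nlinarith [abs_nonneg u]
    · refine continuousOn_const.mul (hH.comp (by fun_prop) fun s hs => ?_)
      simp only [Set.mem_ofPred_eq, Complex.div_ofReal_re] at hs ⊢
      positivity
    · rw [← hL _ (by rw [Complex.div_ofReal_re]; positivity)]
      have := Measure.integral_comp_mul_left
        (fun y : ℝ => m y * Complex.exp (-(s / η) * y)) η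
      rw [abs_of_pos (inv_pos.mpr hη), Complex.real_smul, Complex.ofReal_inv] at this
      rw [← this]
      refine integral_congr_ae (ae_of_all _ fun u => ?_)
      have hη' : (η : ℂ) ≠ 0 := by exact_mod_cast hη.ne'
      simp only
      congr 2
      push_cast
      field_simp
  -- The excess of an increment over `η |w|` is at most `1` by `hlip` and vanishes pointwise in the
  -- limit by `hslow`; dominated convergence applies.
  have hexc : ∀ η : ℝ, 0 < η → Tendsto (fun v : ℝ => ∫ w : ℝ,
      max (‖m (v + η * w) - m v‖ - |η * w|) 0 * ‖K w‖) atTop (𝓝 0) := by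
    intro η hη
    have h0 : ∫ _ : ℝ, (0 : ℝ) = 0 := integral_zero ℝ ℝ
    rw [show 𝓝 (0 : ℝ) = 𝓝 (∫ _ : ℝ, (0 : ℝ)) by rw [h0]]
    refine tendsto_integral_filter_of_dominated_convergence (fun w => ‖K w‖) ?_ ?_ hKn ?_
    · have := K.continuous.measurable
      exact Eventually.of_forall fun v => Measurable.aestronglyMeasurable (by fun_prop)
    · refine Eventually.of_forall fun v => ae_of_all _ fun w => ?_
      rw [norm_mul, norm_norm, Real.norm_of_nonneg (le_max_right _ _)]
      refine mul_le_of_le_one_left (norm_nonneg _) (max_le ?_ zero_le_one)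
      have := hlip (v + η * w) v
      rw [add_sub_cancel_left] at this
      linarith
    · refine ae_of_all _ fun w => ?_
      suffices h : Tendsto (fun v => max (‖m (v + η * w) - m v‖ - |η * w|) 0) atTop (𝓝 0) by
        simpa using h.mul_const ‖K w‖
      refine Metric.tendsto_nhds.mpr fun δ hδ => ?_
      filter_upwards [hslow (η * w) (δ / 2) (half_pos hδ)] with v hv
      rw [Real.dist_0_eq_abs, abs_of_nonneg (le_max_right _ _)]
      exact max_lt (by linarith) hδ
  have hmain : ∀ η : ℝ, 0 < η → ∀ v : ℝ, ‖m v‖ ≤ ‖∫ w : ℝ, m (v + η * w) * K w‖ +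
      (η * J + ∫ w : ℝ, max (‖m (v + η * w) - m v‖ - |η * w|) 0 * ‖K w‖) := by
    intro η hη v
    have hi1 : Integrable fun w : ℝ => (m (v + η * w) - m v) * K w := by
      refine (hKn.add (hKm.const_mul η)).mono' ?_ (ae_of_all _ fun w => ?_)
      · have := K.continuous.measurable
        exact Measurable.aestronglyMeasurable (by fun_prop)
      · have := hlip (v + η * w) v
        rw [add_sub_cancel_left, abs_mul, abs_of_pos hη] at this
        rw [norm_mul]
        exact (mul_le_mul_of_nonneg_right this (norm_nonneg _)).trans_eq (by simp; ring)
    have hi2 : Integrable fun w : ℝ => m v * K w := K.integrable.const_mul _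
    have hi3 : Integrable fun w : ℝ => max (‖m (v + η * w) - m v‖ - |η * w|) 0 * ‖K w‖ := by
      refine hKn.mono' ?_ (ae_of_all _ fun w => ?_)
      · have := K.continuous.measurable
        exact Measurable.aestronglyMeasurable (by fun_prop)
      · rw [norm_mul, norm_norm, Real.norm_of_nonneg (le_max_right _ _)]
        refine mul_le_of_le_one_left (norm_nonneg _) (max_le ?_ zero_le_one)
        have := hlip (v + η * w) v
        rw [add_sub_cancel_left] at this
        linarith
    have hsplit : m v = (∫ w : ℝ, m (v + η * w) * K w) - ∫ w : ℝ, (m (v + η * w) - m v) * K w := by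
      have h1 : ∫ w : ℝ, m (v + η * w) * K w =
          (∫ w : ℝ, (m (v + η * w) - m v) * K w) + ∫ w : ℝ, m v * K w := by
        rw [← integral_add hi1 hi2]
        exact integral_congr_ae (ae_of_all _ fun w => by ring)
      rw [h1, integral_const_mul, hK1]
      ring
    have hd : ‖∫ w : ℝ, (m (v + η * w) - m v) * K w‖ ≤
        η * J + ∫ w : ℝ, max (‖m (v + η * w) - m v‖ - |η * w|) 0 * ‖K w‖ := by
      rw [← integral_const_mul, ← integral_add (hKm.const_mul η) hi3]
      refine norm_integral_le_of_norm_le ((hKm.const_mul η).add hi3) (ae_of_all _ fun w => ?_)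
      rw [norm_mul, ← mul_assoc, ← add_mul]
      refine mul_le_mul_of_nonneg_right ?_ (norm_nonneg _)
      have := le_max_left (‖m (v + η * w) - m v‖ - |η * w|) 0
      rw [abs_mul, abs_of_pos hη] at this ⊢
      linarith
    calc ‖m v‖ = _ := congrArg norm hsplit
      _ ≤ _ := (norm_sub_le _ _).trans (by gcongr)
  refine Metric.tendsto_nhds.mpr fun ε hε => ?_
  -- Chosen so that `η J ≤ ε / 2`; the `+ 1` covers `J = 0`.
  have hη : 0 < ε / (2 * (J + 1)) := by positivity
  have hηJ : ε / (2 * (J + 1)) * J ≤ ε / 2 := by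
    rw [div_mul_eq_mul_div, div_le_div_iff₀ (by positivity) two_pos]
    nlinarith
  have hlim := (hconv _ hη).norm.add (hexc _ hη)
  rw [norm_zero, add_zero] at hlim
  filter_upwards [hlim.eventually_lt_const (half_pos hε)] with v hv
  rw [dist_zero_right]
  have := hmain _ hη v
  linarith

/-! ### From Laplace transforms to Dirichlet series with coefficients bounded by `1 / n`. -/

theorem sum_Ioc_inv_le_log_sub_log {A B : ℕ} (hA : 1 ≤ A) (hAB : A ≤ B) :
    ∑ n ∈ Finset.Ioc A B, (n : ℝ)⁻¹ ≤ Real.log B - Real.log A := by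
  induction B, hAB using Nat.le_induction with
  | base => simp
  | succ B hB ih =>
    rw [Finset.sum_Ioc_succ_top hB]
    have hBpos : (0 : ℝ) < B := by exact_mod_cast hA.trans hB
    have h := Real.one_sub_inv_le_log_of_pos (x := (B + 1) / B) (by positivity)
    rw [Real.log_div (by positivity) (by positivity)] at h
    have h2 : 1 - (((B : ℝ) + 1) / B)⁻¹ = ((B : ℝ) + 1)⁻¹ := by field_simp; ring
    push_cast
    linarith

/-- Rounding `x` down costs `log (x / ⌊x⌋) ≤ 1 / ⌊x⌋`, which is negligible for large `x`. -/
theorem sum_Ioc_floor_inv_le {x y : ℝ} (hx : 1 ≤ x) (hxy : x ≤ y) :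
    ∑ n ∈ Finset.Ioc ⌊x⌋₊ ⌊y⌋₊, (n : ℝ)⁻¹ ≤ Real.log y - Real.log x + (⌊x⌋₊ : ℝ)⁻¹ := by
  have hx1 : 1 ≤ ⌊x⌋₊ := Nat.one_le_floor_iff x |>.mpr hx
  have hxp : (0 : ℝ) < ⌊x⌋₊ := by exact_mod_cast hx1
  have hxy' := Nat.floor_le_floor hxy
  have hyp : (0 : ℝ) < ⌊y⌋₊ := by exact_mod_cast hx1.trans hxy'
  have h1 := sum_Ioc_inv_le_log_sub_log hx1 hxy'
  have h2 : Real.log ⌊y⌋₊ ≤ Real.log y := Real.log_le_log hyp (Nat.floor_le (by linarith))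
  have h3 := Real.log_le_sub_one_of_pos (x := x / ⌊x⌋₊) (by positivity)
  rw [Real.log_div (by positivity) hxp.ne'] at h3
  have h4 : x / ⌊x⌋₊ ≤ 1 + (⌊x⌋₊ : ℝ)⁻¹ := by
    rw [div_le_iff₀ hxp, add_mul, inv_mul_cancel₀ hxp.ne', one_mul]
    exact (Nat.lt_floor_add_one x).le
  linarith

theorem norm_sum_floor_exp_sub_le {b : ℕ → ℂ} (hb : ∀ n, ‖b n‖ ≤ (n : ℝ)⁻¹) {u v : ℝ}
    (huv : u ≤ v) :
    ‖∑ n ∈ Finset.Icc 1 ⌊Real.exp v⌋₊, b n - ∑ n ∈ Finset.Icc 1 ⌊Real.exp u⌋₊, b n‖ ≤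
      ∑ n ∈ Finset.Ioc ⌊Real.exp u⌋₊ ⌊Real.exp v⌋₊, (n : ℝ)⁻¹ := by
  have h : ∀ N, Finset.Icc 1 N = Finset.Ioc 0 N := fun N => rfl
  rw [h, h, ← Finset.sum_Ioc_consecutive _ (Nat.zero_le _)
    (Nat.floor_le_floor (Real.exp_le_exp.mpr huv)), add_sub_cancel_left]
  exact norm_sum_le_of_le _ fun n _ => hb n

theorem norm_sum_floor_exp_sub_le_one_add {b : ℕ → ℂ} (hb : ∀ n, ‖b n‖ ≤ (n : ℝ)⁻¹) (u v : ℝ) :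
    ‖∑ n ∈ Finset.Icc 1 ⌊Real.exp u⌋₊, b n - ∑ n ∈ Finset.Icc 1 ⌊Real.exp v⌋₊, b n‖ ≤
      1 + |u - v| := by
  wlog huv : v ≤ u generalizing u v
  · rw [norm_sub_rev, abs_sub_comm]
    exact this v u (le_of_not_ge huv)
  refine (norm_sum_floor_exp_sub_le hb huv).trans ?_
  rw [abs_of_nonneg (sub_nonneg.mpr huv)]
  rcases le_or_gt 0 v with hv | hv
  · have h := sum_Ioc_floor_inv_le (Real.one_le_exp hv) (Real.exp_le_exp.mpr huv)
    rw [Real.log_exp, Real.log_exp] at h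
    have : (⌊Real.exp v⌋₊ : ℝ)⁻¹ ≤ 1 := Nat.cast_inv_le_one _
    linarith
  -- For `v < 0` the sum at `v` is empty, and the harmonic bound `1 + log` gives the constant `1`.
  · rw [Nat.floor_eq_zero.mpr (Real.exp_lt_one_iff.mpr hv)]
    rcases le_or_gt 0 u with hu | hu
    · have h := harmonic_floor_le_one_add_log (Real.exp u) (Real.one_le_exp hu)
      rw [Real.log_exp, harmonic_eq_sum_Icc] at h
      push_cast at h
      have h2 : ∀ N, Finset.Icc 1 N = Finset.Ioc 0 N := fun N => rfl
      rw [h2] at h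
      linarith
    · rw [Nat.floor_eq_zero.mpr (Real.exp_lt_one_iff.mpr hu)]
      simp only [Finset.Ioc_self, Finset.sum_empty]
      linarith

theorem eventually_norm_sum_floor_exp_sub_le {b : ℕ → ℂ} (hb : ∀ n, ‖b n‖ ≤ (n : ℝ)⁻¹) (w : ℝ)
    {δ : ℝ} (hδ : 0 < δ) :
    ∀ᶠ v in atTop, ‖∑ n ∈ Finset.Icc 1 ⌊Real.exp (v + w)⌋₊, b n -
      ∑ n ∈ Finset.Icc 1 ⌊Real.exp v⌋₊, b n‖ ≤ |w| + δ := by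
  have hlim : Tendsto (fun v : ℝ => (⌊Real.exp v⌋₊ : ℝ)⁻¹) atTop (𝓝 0) :=
    (tendsto_inv_atTop_zero.comp tendsto_natCast_atTop_atTop).comp
      (tendsto_nat_floor_atTop.comp Real.tendsto_exp_atTop)
  have hlim2 : Tendsto (fun v : ℝ => (⌊Real.exp (v + w)⌋₊ : ℝ)⁻¹) atTop (𝓝 0) :=
    hlim.comp (tendsto_atTop_add_const_right _ _ tendsto_id)
  filter_upwards [hlim.eventually_lt_const hδ, hlim2.eventually_lt_const hδ,
    eventually_ge_atTop 0, eventually_ge_atTop (-w)] with v h1 h2 hv hvw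
  rcases le_total 0 w with hw | hw
  · have h := sum_Ioc_floor_inv_le (Real.one_le_exp hv)
      (Real.exp_le_exp.mpr (le_add_of_nonneg_right hw))
    rw [Real.log_exp, Real.log_exp] at h
    rw [abs_of_nonneg hw]
    have := norm_sum_floor_exp_sub_le hb (le_add_of_nonneg_right hw : v ≤ v + w)
    linarith
  · have h := sum_Ioc_floor_inv_le (Real.one_le_exp (by linarith : 0 ≤ v + w))
      (Real.exp_le_exp.mpr (add_le_of_nonpos_right hw))
    rw [Real.log_exp, Real.log_exp] at h
    rw [abs_of_nonpos hw, norm_sub_rev]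
    have := norm_sum_floor_exp_sub_le hb (add_le_of_nonpos_right hw : v + w ≤ v)
    linarith

theorem isBigO_sum_norm_rpow {b : ℕ → ℂ} (hb : ∀ n, ‖b n‖ ≤ (n : ℝ)⁻¹) {r : ℝ} (hr : 0 < r) :
    (fun n : ℕ => ∑ k ∈ Finset.Icc 1 n, ‖b k‖) =O[atTop] fun n : ℕ => (n : ℝ) ^ r := by
  have h1 : (fun n : ℕ => ∑ k ∈ Finset.Icc 1 n, ‖b k‖) =O[atTop]
      fun n : ℕ => 1 + Real.log n := by
    refine Asymptotics.isBigO_of_le _ fun n => ?_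
    rw [Real.norm_of_nonneg (Finset.sum_nonneg fun _ _ => norm_nonneg _), Real.norm_eq_abs]
    refine le_trans ((Finset.sum_le_sum fun k _ => hb k).trans ?_) (le_abs_self _)
    have := harmonic_le_one_add_log n
    rw [harmonic_eq_sum_Icc] at this
    push_cast at this
    exact this
  refine h1.trans (Asymptotics.IsBigO.comp_tendsto (f := fun x : ℝ => 1 + Real.log x)
    (g := fun x : ℝ => x ^ r) ?_ tendsto_natCast_atTop_atTop)
  refine Asymptotics.IsBigO.add ?_ (isLittleO_log_rpow_atTop hr).isBigO
  refine Asymptotics.IsBigO.of_bound 1 ?_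
  filter_upwards [eventually_ge_atTop 1] with x hx
  rw [norm_one, one_mul]
  exact (Real.one_le_rpow hx hr.le).trans (le_abs_self _)

-- Abel summation with `t = exp u`; the integral extends to the whole line because the sum is empty
-- for `u < 0`. The growth exponent `s.re / 2` is one choice strictly between `0` and `s.re`.
open MeasureTheory in
theorem LSeries_eq_mul_laplace {b : ℕ → ℂ} (hb : ∀ n, ‖b n‖ ≤ (n : ℝ)⁻¹) {s : ℂ} (hs : 0 < s.re) :
    LSeries b s = s * ∫ u : ℝ, (∑ n ∈ Finset.Icc 1 ⌊Real.exp u⌋₊, b n) * Complex.exp (-s * u) := by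
  have h1 := integral_comp_exp_Ioi
    (fun t : ℝ => (∑ n ∈ Finset.Icc 1 ⌊t⌋₊, b n) * (t : ℂ) ^ (-(s + 1))) 0
  rw [Real.exp_zero] at h1
  have h2 : ∫ u in Set.Ici (0 : ℝ), (∑ n ∈ Finset.Icc 1 ⌊Real.exp u⌋₊, b n) *
      Complex.exp (-s * u) =
      ∫ u : ℝ, (∑ n ∈ Finset.Icc 1 ⌊Real.exp u⌋₊, b n) * Complex.exp (-s * u) := by
    refine setIntegral_eq_integral_of_forall_compl_eq_zero fun u hu => ?_
    rw [Nat.floor_eq_zero.mpr (Real.exp_lt_one_iff.mpr (not_le.mp hu))]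
    simp
  rw [LSeries_eq_mul_integral' b (half_pos hs).le (half_lt_self hs)
    (isBigO_sum_norm_rpow hb (half_pos hs)), ← h1, ← h2, integral_Ici_eq_integral_Ioi]
  congr 1
  refine setIntegral_congr_fun measurableSet_Ioi fun u _ => ?_
  simp only [Complex.real_smul]
  rw [Complex.cpow_def_of_ne_zero (Complex.ofReal_ne_zero.mpr (Real.exp_ne_zero u)),
    ← Complex.ofReal_log (Real.exp_pos u).le, Real.log_exp, mul_left_comm, Complex.ofReal_exp,
    ← Complex.exp_add]
  congr 2
  ring

/-- A Tauberian theorem: coefficients bounded by `1 / n` have partial sums tending to zero as soon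
as their Dirichlet series, divided by `s`, extends continuously to the closed right half plane. -/
theorem tendsto_sum_zero_of_LSeries {b : ℕ → ℂ} (hb : ∀ n, ‖b n‖ ≤ (n : ℝ)⁻¹) {H : ℂ → ℂ}
    (hH : ContinuousOn H {s | 0 ≤ s.re}) (hL : ∀ s : ℂ, 0 < s.re → LSeries b s = s * H s) :
    Tendsto (fun N : ℕ => ∑ n ∈ Finset.Icc 1 N, b n) atTop (𝓝 0) := by
  have h := tendsto_zero_of_slowlyVarying_of_laplace
    (m := fun u => ∑ n ∈ Finset.Icc 1 ⌊Real.exp u⌋₊, b n) (H := H)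
    ((Measurable.of_discrete (f := fun N : ℕ => ∑ n ∈ Finset.Icc 1 N, b n)).comp
      (Nat.measurable_floor.comp Real.measurable_exp))
    (fun u hu => by rw [Nat.floor_eq_zero.mpr (Real.exp_lt_one_iff.mpr hu)]; simp)
    (norm_sum_floor_exp_sub_le_one_add hb)
    (fun w δ hδ => eventually_norm_sum_floor_exp_sub_le hb w hδ) hH
    fun s hs => by
      have h0 : s ≠ 0 := fun h => by simp [h] at hs
      exact mul_left_cancel₀ h0 ((LSeries_eq_mul_laplace hb hs).symm.trans (hL s hs))
  refine (h.comp (Real.tendsto_log_atTop.comp tendsto_natCast_atTop_atTop)).congr' ?_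
  filter_upwards [eventually_gt_atTop 0] with N hN
  simp only [Function.comp]
  rw [Real.exp_log (by exact_mod_cast hN), Nat.floor_natCast]

/-! ### The Möbius form of the prime number theorem. -/

/-- The prime number theorem for the Möbius function restricted to integers coprime to `N`. -/
theorem tendsto_sum_trivChar_mul_moebius_div (N : ℕ) [NeZero N] :
    Tendsto (fun Q : ℕ => ∑ n ∈ Finset.Icc 1 Q,
      (1 : DirichletCharacter ℂ N) n * (ArithmeticFunction.moebius n : ℂ) / n) atTop (𝓝 0) := by
  -- Here `H(s) = 1/(s L(1+s))` with the pole of `L` at `1` removed: the denominator is entire,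
  -- nonzero at `s = 0` (the residue) and nonzero elsewhere on `Re s ≥ 0` by nonvanishing of `L`.
  refine tendsto_sum_zero_of_LSeries
    (H := fun s => (DirichletCharacter.LFunctionTrivChar₁ N (1 + s))⁻¹) (fun n => ?_) ?_ ?_
  · rw [norm_div, norm_mul, Complex.norm_natCast, div_eq_mul_inv]
    refine mul_le_of_le_one_left (by positivity)
      (mul_le_one₀ (DirichletCharacter.norm_le_one _ _) (norm_nonneg _) ?_)
    rw [Complex.norm_intCast]
    exact_mod_cast ArithmeticFunction.abs_moebius_le_one
  · refine ContinuousOn.inv₀ ?_ fun s hs => ?_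
    · exact ((DirichletCharacter.differentiable_LFunctionTrivChar₁ N).continuous.comp
        (by fun_prop : Continuous fun s : ℂ => 1 + s)).continuousOn
    · rcases eq_or_ne s 0 with rfl | h0
      · simpa using DirichletCharacter.LFunctionTrivChar₁_apply_one_ne_zero N
      · have h1 : 1 + s ≠ 1 := by simpa using h0
        rw [DirichletCharacter.LFunctionTrivChar₁, Function.update_of_ne h1]
        refine mul_ne_zero (sub_ne_zero.mpr h1)
          (DirichletCharacter.LFunction_ne_zero_of_one_le_re 1 (.inr h1) ?_)
        simpa using hs
  · intro s hs
    have h0 : s ≠ 0 := fun h => by simp [h] at hs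
    have h1 : 1 + s ≠ 1 := by simpa using h0
    have h2 : 1 < (1 + s).re := by simpa using hs
    have h3 := DirichletCharacter.LSeries.mul_mu_eq_one (1 : DirichletCharacter ℂ N) h2
    rw [← DirichletCharacter.LFunction_eq_LSeries _ h2] at h3
    rw [DirichletCharacter.LFunctionTrivChar₁, Function.update_of_ne h1, add_sub_cancel_left,
      mul_inv, mul_inv_cancel_left₀ h0, DirichletCharacter.LFunctionTrivChar,
      ← eq_inv_of_mul_eq_one_right h3]
    refine tsum_congr fun n => ?_
    rcases eq_or_ne n 0 with rfl | hn
    · simp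
    · have hn' : (n : ℂ) ≠ 0 := by exact_mod_cast hn
      rw [LSeries.term_of_ne_zero hn, LSeries.term_of_ne_zero hn, Complex.cpow_add _ _ hn',
        Complex.cpow_one, div_div]
      rfl

/-! ### Ramanujan sums: Möbius formula, multiplicativity, values at prime powers. -/

open ArithmeticFunction

theorem ramanujanSum_eq_sum_primitiveRoots {q : ℕ} (hq : q ≠ 0) (a : ℕ) :
    ramanujanSum q a = ∑ ζ ∈ primitiveRoots q ℂ, ζ ^ a := by
  have hexp : ∀ h : ℕ, Complex.exp (2 * Real.pi * Complex.I * (h / q)) =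
      Complex.exp (2 * Real.pi * Complex.I / q) ^ h := by
    intro h
    rw [← Complex.exp_nat_mul]
    congr 1
    ring
  have hω := Complex.isPrimitiveRoot_exp q hq
  -- For `q = 1` the only index is `h = q`; for `q > 1` coprimality forces `h < q`, where powers of
  -- the root are distinct.
  rcases eq_or_ne q 1 with rfl | hq1
  · have : Complex.exp (2 * Real.pi * Complex.I * a) = 1 := by
      rw [mul_comm]
      exact Complex.exp_nat_mul_two_pi_mul_I a
    simp [ramanujanSum, this]
  have hlt : ∀ h ∈ (Finset.Icc 1 q).filter (fun h => Nat.Coprime h q), h < q := by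
    intro h hh
    rw [Finset.mem_filter, Finset.mem_Icc] at hh
    refine lt_of_le_of_ne hh.1.2 fun heq => hq1 ?_
    simpa [heq] using hh.2
  refine Finset.sum_nbij (fun h => Complex.exp (2 * Real.pi * Complex.I * (h / q)))
    (fun h hh => ?_) (fun h hh j hj hhj => ?_) (fun ζ hζ => ?_) (fun h _ => ?_)
  · rw [mem_primitiveRoots (Nat.pos_of_ne_zero hq)]
    exact Complex.isPrimitiveRoot_exp_of_coprime h q hq (Finset.mem_filter.mp hh).2
  · simp only [hexp] at hhj
    exact hω.pow_inj (hlt h hh) (hlt j hj) hhj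
  · rw [Finset.mem_coe, mem_primitiveRoots (Nat.pos_of_ne_zero hq),
      Complex.isPrimitiveRoot_iff _ _ hq] at hζ
    obtain ⟨i, hi, hiq, rfl⟩ := hζ
    refine ⟨i, ?_, rfl⟩
    rw [Finset.mem_coe, Finset.mem_filter, Finset.mem_Icc]
    refine ⟨⟨Nat.one_le_iff_ne_zero.mpr fun h0 => hq1 ?_, hi.le⟩, hiq⟩
    simpa [h0] using hiq
  · rw [← Complex.exp_nat_mul]
    congr 1
    ring

theorem sum_nthRootsFinset_pow {q : ℕ} (hq : q ≠ 0) (a : ℕ) :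
    ∑ ζ ∈ Polynomial.nthRootsFinset q (1 : ℂ), ζ ^ a = if q ∣ a then (q : ℂ) else 0 := by
  obtain ⟨ω, hω⟩ : ∃ ω : ℂ, IsPrimitiveRoot ω q := ⟨_, Complex.isPrimitiveRoot_exp q hq⟩
  have hpos := Nat.pos_of_ne_zero hq
  have : NeZero q := ⟨hq⟩
  have h : ∑ i ∈ Finset.range q, (ω ^ a) ^ i =
      ∑ ζ ∈ Polynomial.nthRootsFinset q (1 : ℂ), ζ ^ a := by
    refine Finset.sum_nbij (fun i => ω ^ i) (fun i _ => ?_) hω.injOn_pow (fun ζ hζ => ?_)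
      (fun i _ => ?_)
    · rw [Polynomial.mem_nthRootsFinset hpos, ← pow_mul, mul_comm, pow_mul, hω.pow_eq_one, one_pow]
    · rw [Finset.mem_coe, Polynomial.mem_nthRootsFinset hpos] at hζ
      obtain ⟨i, hi, rfl⟩ := hω.eq_pow_of_pow_eq_one hζ
      exact ⟨i, by simpa using hi, rfl⟩
    · rw [← pow_mul, ← pow_mul, mul_comm]
  rw [← h]
  split_ifs with hqa
  · simp [(hω.pow_eq_one_iff_dvd a).mpr hqa]
  · have h1 : ω ^ a ≠ 1 := fun h => hqa ((hω.pow_eq_one_iff_dvd a).mp h)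
    rw [geom_sum_eq h1, ← pow_mul, mul_comm, pow_mul, hω.pow_eq_one, one_pow, sub_self, zero_div]

/-- Group all `q`-th roots of unity by exact order. -/
theorem sum_divisors_ramanujanSum {q : ℕ} (hq : q ≠ 0) (a : ℕ) :
    ∑ d ∈ q.divisors, ramanujanSum d a = if q ∣ a then (q : ℂ) else 0 := by
  classical
  rw [← sum_nthRootsFinset_pow hq, IsPrimitiveRoot.nthRoots_one_eq_biUnion_primitiveRoots,
    Finset.sum_biUnion fun i _ j _ hij => IsPrimitiveRoot.disjoint hij]
  exact Finset.sum_congr rfl fun d hd =>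
    ramanujanSum_eq_sum_primitiveRoots (Nat.pos_of_mem_divisors hd).ne' a

/-- The restriction of an arithmetic function to the divisors of `D`. -/
noncomputable def restrictDvd (f : ArithmeticFunction ℂ) (D : ℕ) : ArithmeticFunction ℂ :=
  ⟨fun n => if n ∣ D then f n else 0, by simp⟩

theorem restrictDvd_apply (f : ArithmeticFunction ℂ) (D n : ℕ) :
    restrictDvd f D n = if n ∣ D then f n else 0 := rfl

theorem isMultiplicative_restrictDvd {f : ArithmeticFunction ℂ} (hf : f.IsMultiplicative) (D : ℕ) :
    (restrictDvd f D).IsMultiplicative := by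
  refine ⟨by simp [restrictDvd_apply, hf.map_one], fun {m n} hmn => ?_⟩
  simp only [restrictDvd_apply]
  by_cases hm : m ∣ D
  · by_cases hn : n ∣ D
    · rw [if_pos hm, if_pos hn, if_pos (hmn.mul_dvd_of_dvd_of_dvd hm hn), hf.map_mul_of_coprime hmn]
    · rw [if_neg hn, mul_zero, if_neg fun h => hn ((Dvd.intro_left m rfl).trans h)]
  · rw [if_neg hm, zero_mul, if_neg fun h => hm ((Dvd.intro n rfl).trans h)]

/-- The Ramanujan sum `q ↦ c_q(a)` as an arithmetic function. -/
noncomputable def ramanujanArith (a : ℕ) : ArithmeticFunction ℂ :=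
  ⟨fun q => ramanujanSum q a, by simp [ramanujanSum]⟩

theorem ramanujanArith_apply (a q : ℕ) : ramanujanArith a q = ramanujanSum q a := rfl

/-- Möbius inversion of the divisor sum, that is `c_q(a) = ∑_{d ∣ gcd(q, a)} d μ(q/d)`. -/
theorem ramanujanArith_eq_mul_moebius (a : ℕ) :
    ramanujanArith a = restrictDvd ((ArithmeticFunction.id : ArithmeticFunction ℕ) :
      ArithmeticFunction ℂ) a * ((moebius : ArithmeticFunction ℤ) : ArithmeticFunction ℂ) := by
  have h : ramanujanArith a * ((zeta : ArithmeticFunction ℕ) : ArithmeticFunction ℂ) =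
      restrictDvd ((ArithmeticFunction.id : ArithmeticFunction ℕ) : ArithmeticFunction ℂ) a := by
    ext q
    rcases eq_or_ne q 0 with rfl | hq
    · simp
    · rw [coe_mul_zeta_apply, restrictDvd_apply]
      simp only [ramanujanArith_apply]
      rw [sum_divisors_ramanujanSum hq]
      simp
  rw [← h, mul_assoc, coe_zeta_mul_coe_moebius, mul_one]

theorem isMultiplicative_ramanujanArith (a : ℕ) : (ramanujanArith a).IsMultiplicative := by
  rw [ramanujanArith_eq_mul_moebius]
  exact (isMultiplicative_restrictDvd isMultiplicative_id.natCast a).mul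
    isMultiplicative_moebius.intCast

theorem ramanujanArith_apply_of_coprime {a n : ℕ} (h : n.Coprime a) :
    ramanujanArith a n = moebius n := by
  rcases eq_or_ne n 0 with rfl | hn
  · simp
  rw [ramanujanArith_eq_mul_moebius, mul_apply, Finset.sum_eq_single (1, n)]
  · simp [restrictDvd_apply]
  · rintro ⟨x, y⟩ hxy hne
    rw [Nat.mem_divisorsAntidiagonal] at hxy
    rw [restrictDvd_apply, if_neg, zero_mul]
    intro hxa
    have hx : x = 1 := Nat.eq_one_of_dvd_coprimes h (Dvd.intro y hxy.1) hxa
    subst hx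
    exact hne (by simpa using hxy.1)
  · intro h1
    exact absurd (Nat.mem_divisorsAntidiagonal.mpr ⟨one_mul n, hn⟩) h1

/-- In `p^k = x y` with `x ∣ a`, a nonzero `μ(y)` needs `y ∣ p`, which would give `p^k ∣ a p`. -/
theorem ramanujanArith_prime_pow_eq_zero {a p k : ℕ} (hp : p.Prime) (h : ¬ p ^ k ∣ a * p) :
    ramanujanArith a (p ^ k) = 0 := by
  rw [ramanujanArith_eq_mul_moebius, mul_apply]
  refine Finset.sum_eq_zero ?_
  rintro ⟨x, y⟩ hxy
  rw [Nat.mem_divisorsAntidiagonal] at hxy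
  simp only at hxy
  rw [restrictDvd_apply]
  split_ifs with hxa
  · obtain ⟨j, -, rfl⟩ := (Nat.dvd_prime_pow hp).mp (Dvd.intro_left x hxy.1)
    have hj : 2 ≤ j := by
      by_contra! hj
      refine h (hxy.1 ▸ mul_dvd_mul hxa ?_)
      simpa using pow_dvd_pow p (Nat.lt_succ_iff.mp hj)
    rw [intCoe_apply, moebius_apply_prime_pow hp (by omega), if_neg (by omega)]
    simp
  · exact zero_mul _

/-! ### Splitting off the bad primes by a finite convolution. -/

/-- The arithmetic function `n ↦ μ(n) / n` restricted to integers coprime to `N`. -/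
noncomputable def coprimeMoebiusDiv (N : ℕ) : ArithmeticFunction ℂ :=
  ⟨fun n => (1 : DirichletCharacter ℂ N) n * (moebius n : ℂ) / n, by simp⟩

theorem coprimeMoebiusDiv_apply (N n : ℕ) :
    coprimeMoebiusDiv N n = (1 : DirichletCharacter ℂ N) n * (moebius n : ℂ) / n := rfl

theorem isMultiplicative_coprimeMoebiusDiv (N : ℕ) : (coprimeMoebiusDiv N).IsMultiplicative := by
  refine ⟨by simp [coprimeMoebiusDiv_apply], fun {m n} hmn => ?_⟩
  simp only [coprimeMoebiusDiv_apply, isMultiplicative_moebius.map_mul_of_coprime hmn,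
    Nat.cast_mul, map_mul, Int.cast_mul]
  rw [div_mul_div_comm]
  ring

theorem coprimeMoebiusDiv_of_coprime {N n : ℕ} (h : n.Coprime N) :
    coprimeMoebiusDiv N n = moebius n / n := by
  rw [coprimeMoebiusDiv_apply, MulChar.one_apply ((ZMod.isUnit_iff_coprime n N).mpr h), one_mul]

theorem coprimeMoebiusDiv_of_not_coprime {N n : ℕ} (h : ¬ n.Coprime N) :
    coprimeMoebiusDiv N n = 0 := by
  rw [coprimeMoebiusDiv_apply,
    MulChar.map_nonunit _ fun hu => h ((ZMod.isUnit_iff_coprime n N).mp hu),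
    zero_mul, zero_div]

/-- Away from the primes dividing `N`, a multiplicative function that agrees with `μ(n) / n` on
prime powers and is supported on divisors of `D` at the other prime powers factors as a
convolution. -/
theorem eq_restrictDvd_mul_coprimeMoebiusDiv {f : ArithmeticFunction ℂ} (hf : f.IsMultiplicative)
    {N D : ℕ} (hDN : ∀ p : ℕ, p.Prime → p ∣ D → p ∣ N)
    (hsupp : ∀ p k : ℕ, p.Prime → p ∣ N → ¬ p ^ k ∣ D → f (p ^ k) = 0)
    (hcop : ∀ p k : ℕ, p.Prime → ¬ p ∣ N → f (p ^ k) = (moebius (p ^ k) : ℂ) / (p ^ k : ℕ)) :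
    f = restrictDvd f D * coprimeMoebiusDiv N := by
  have hr := isMultiplicative_restrictDvd hf D
  have hg := isMultiplicative_coprimeMoebiusDiv N
  refine (hf.eq_iff_eq_on_prime_powers f _ (hr.mul hg)).mpr fun p k hp => ?_
  have hpk : p ^ k ≠ 0 := pow_ne_zero k hp.ne_zero
  rw [mul_apply]
  -- On powers of `p` one factor is trivial: the Möbius factor if `p ∣ N`, and otherwise the
  -- restricted one, as then `p ∤ D` by `hDN`.
  by_cases hpN : p ∣ N
  · rw [Finset.sum_eq_single (p ^ k, 1)]
    · rw [hg.map_one, mul_one, restrictDvd_apply]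
      split_ifs with h
      · rfl
      · exact hsupp p k hp hpN h
    · rintro ⟨x, y⟩ hxy hne
      rw [Nat.mem_divisorsAntidiagonal] at hxy
      simp only at hxy
      obtain ⟨j, -, rfl⟩ := (Nat.dvd_prime_pow hp).mp (Dvd.intro_left x hxy.1)
      rw [coprimeMoebiusDiv_of_not_coprime, mul_zero]
      intro hc
      rcases Nat.eq_zero_or_pos j with rfl | hj
      · exact hne (by simpa using hxy.1)
      · exact hp.coprime_iff_not_dvd.mp (hc.coprime_dvd_left (dvd_pow_self p hj.ne')) hpN
    · exact fun h => absurd (Nat.mem_divisorsAntidiagonal.mpr ⟨mul_one _, hpk⟩) h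
  · have hcopk : (p ^ k).Coprime N := (hp.coprime_iff_not_dvd.mpr hpN).pow_left k
    rw [Finset.sum_eq_single (1, p ^ k)]
    · rw [hr.map_one, one_mul, coprimeMoebiusDiv_of_coprime hcopk, hcop p k hp hpN]
    · rintro ⟨x, y⟩ hxy hne
      rw [Nat.mem_divisorsAntidiagonal] at hxy
      simp only at hxy
      obtain ⟨j, -, rfl⟩ := (Nat.dvd_prime_pow hp).mp (Dvd.intro y hxy.1)
      rw [restrictDvd_apply, if_neg, zero_mul]
      intro hD
      rcases Nat.eq_zero_or_pos j with rfl | hj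
      · exact hne (by simpa using hxy.1)
      · exact hpN (hDN p hp ((dvd_pow_self p hj.ne').trans hD))
    · exact fun h => absurd (Nat.mem_divisorsAntidiagonal.mpr ⟨one_mul _, hpk⟩) h

/-- For `Q ≥ D` the partial sum is a fixed finite combination, over `d ∣ D`, of partial sums of `g`
up to `Q / d`. -/
theorem tendsto_sum_restrictDvd_mul (f g : ArithmeticFunction ℂ) {D : ℕ} (hD : D ≠ 0)
    (hg : Tendsto (fun Q : ℕ => ∑ n ∈ Finset.Icc 1 Q, g n) atTop (𝓝 0)) :
    Tendsto (fun Q : ℕ => ∑ n ∈ Finset.Icc 1 Q, (restrictDvd f D * g) n) atTop (𝓝 0) := by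
  have h : Tendsto (fun Q : ℕ => ∑ d ∈ D.divisors,
      restrictDvd f D d * ∑ m ∈ Finset.Icc 1 (Q / d), g m) atTop (𝓝 0) := by
    rw [show (0 : ℂ) = ∑ d ∈ D.divisors, restrictDvd f D d * 0 by simp]
    exact tendsto_finsetSum _ fun d hd => (hg.comp
      (Nat.tendsto_div_const_atTop (Nat.pos_of_mem_divisors hd).ne')).const_mul _
  refine h.congr' ?_
  filter_upwards [eventually_ge_atTop D] with Q hQ
  have hIcc : ∀ N, Finset.Icc 1 N = Finset.Ioc 0 N := fun N => rfl
  simp only [hIcc]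
  rw [sum_Ioc_mul_eq_sum_sum]
  refine Finset.sum_subset (fun d hd => ?_) fun d _ hd => ?_
  · exact Finset.mem_Ioc.mpr ⟨Nat.pos_of_mem_divisors hd, (Nat.divisor_le hd).trans hQ⟩
  · rw [restrictDvd_apply, if_neg fun h => hd (Nat.mem_divisors.mpr ⟨h, hD⟩), zero_mul]

/-! ### Convergence to zero and failure of absolute convergence. -/

theorem ramanujanSeriesTendsto_zero {p₀ : ℕ} {G : ArithmeticFunction ℂ} (hp₀ : p₀.Prime)
    (hG : G.IsMultiplicative) (hGp : ∀ p : ℕ, p.Prime → p ≠ p₀ → G p = 1 / (p : ℂ)) {a : ℕ}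
    (ha : a ≠ 0) : RamanujanSeriesTendsto G a 0 := by
  have hN : a * p₀ ≠ 0 := mul_ne_zero ha hp₀.ne_zero
  have : NeZero (a * p₀) := ⟨hN⟩
  have hD : a * (a * p₀) ≠ 0 := mul_ne_zero ha hN
  -- The bad primes are those dividing `N = a p₀`. For them a nonzero term needs `p^k ∣ a p`, and `a
  -- p` divides `D = a (a p₀)`.
  have key : G.pmul (ramanujanArith a) = restrictDvd (G.pmul (ramanujanArith a)) (a * (a * p₀)) *
      coprimeMoebiusDiv (a * p₀) := by
    refine eq_restrictDvd_mul_coprimeMoebiusDiv (hG.pmul (isMultiplicative_ramanujanArith a))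
      (fun p hp h => ?_) (fun p k hp hpN h => ?_) fun p k hp hpN => ?_
    · exact (hp.dvd_mul.mp h).elim (fun h => h.mul_right p₀) id
    · rw [pmul_apply, ramanujanArith_prime_pow_eq_zero hp, mul_zero]
      exact fun h' => h (h'.trans (mul_dvd_mul_left a hpN))
    · have hpa : ¬ p ∣ a := fun h => hpN (h.mul_right p₀)
      have hpp : p ≠ p₀ := fun h => hpN (h ▸ Dvd.intro_left a rfl)
      rw [pmul_apply, ramanujanArith_apply_of_coprime ((hp.coprime_iff_not_dvd.mpr hpa).pow_left k)]
      rcases Nat.eq_zero_or_pos k with rfl | hk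
      · simp [hG.map_one]
      · rw [moebius_apply_prime_pow hp hk.ne']
        split_ifs with h1
        · subst h1
          rw [pow_one, hGp p hp hpp]
          ring
        · simp
  have h := tendsto_sum_restrictDvd_mul (G.pmul (ramanujanArith a)) (coprimeMoebiusDiv (a * p₀)) hD
    (tendsto_sum_trivChar_mul_moebius_div (a * p₀))
  rwa [← key] at h

/-- At all but finitely many primes the term has modulus `1/p`, and `∑ 1/p` diverges. -/
theorem not_ramanujanSeriesAbsConv {p₀ : ℕ} {G : ArithmeticFunction ℂ}
    (hGp : ∀ p : ℕ, p.Prime → p ≠ p₀ → G p = 1 / (p : ℂ)) {a : ℕ} (ha : a ≠ 0) :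
    ¬ RamanujanSeriesAbsConv G a := by
  intro h
  refine Nat.Primes.not_summable_one_div ((h.comp_injective
    (Subtype.val_injective : Function.Injective ((↑) : Nat.Primes → ℕ))).congr_cofinite ?_)
  have hfin : {p : Nat.Primes | (p : ℕ) ∣ a ∨ (p : ℕ) = p₀}.Finite := by
    refine Set.Finite.of_finite_image (f := ((↑) : Nat.Primes → ℕ))
      ((Finset.finite_toSet (insert p₀ a.divisors)).subset ?_) Subtype.val_injective.injOn
    rintro _ ⟨p, hp | hp, rfl⟩
    · simp [hp, ha]
    · simp [hp]
  filter_upwards [hfin.compl_mem_cofinite] with p hp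
  have hp' : ¬ ((p : ℕ) ∣ a ∨ (p : ℕ) = p₀) := hp
  rw [not_or] at hp'
  have hcop : (p : ℕ).Coprime a := p.2.coprime_iff_not_dvd.mpr hp'.1
  rw [Function.comp_apply, ← ramanujanArith_apply, ramanujanArith_apply_of_coprime hcop,
    moebius_apply_prime p.2, hGp p p.2 hp'.2]
  simp

/-! ### An explicit exotic function, with `p₀ = 2`, and the conclusion. -/

/-- The reciprocal of the odd part. -/
noncomputable def invOddPart : ArithmeticFunction ℂ :=
  ⟨fun n => if n = 0 then 0 else ((ordCompl[2] n : ℕ) : ℂ)⁻¹, by simp⟩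

theorem invOddPart_apply {n : ℕ} (hn : n ≠ 0) : invOddPart n = ((ordCompl[2] n : ℕ) : ℂ)⁻¹ :=
  if_neg hn

theorem isMultiplicative_invOddPart : invOddPart.IsMultiplicative := by
  refine IsMultiplicative.iff_ne_zero.mpr ⟨by simp [invOddPart_apply], fun {m n} hm hn _ => ?_⟩
  rw [invOddPart_apply hm, invOddPart_apply hn, invOddPart_apply (mul_ne_zero hm hn),
    Nat.ordCompl_mul, Nat.cast_mul, mul_inv]

theorem invOddPart_two_pow (k : ℕ) : invOddPart (2 ^ k) = 1 := by
  rw [invOddPart_apply (by positivity), Nat.ordCompl_self_pow Nat.prime_two, Nat.cast_one, inv_one]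

theorem invOddPart_prime {p : ℕ} (hp : p.Prime) (hp2 : p ≠ 2) : invOddPart p = 1 / (p : ℂ) := by
  have h2 : ¬ 2 ∣ p := fun h => hp2 ((Nat.prime_dvd_prime_iff_eq Nat.prime_two hp).mp h).symm
  rw [invOddPart_apply hp.ne_zero, Nat.factorization_eq_zero_of_not_dvd h2, pow_zero, Nat.div_one,
    one_div]

theorem mainTheorem8 :
    (∀ (p₀ : ℕ) (G₀ : ArithmeticFunction ℂ), p₀.Prime → G₀.IsMultiplicative →
      (∀ k : ℕ, 1 ≤ k → G₀ (p₀ ^ k) = 1) →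
      (∀ p : ℕ, p.Prime → p ≠ p₀ → G₀ p = 1 / (p : ℂ)) →
        IsExotic G₀ ∧
        ∀ a : ℕ, 1 ≤ a → RamanujanSeriesTendsto G₀ a 0 ∧ ¬ RamanujanSeriesAbsConv G₀ a) ∧
    (∃ G : ArithmeticFunction ℂ, IsExotic G ∧ G ∈ ramanujanCloud 0 ∧
      ∀ a : ℕ, 1 ≤ a → ¬ RamanujanSeriesAbsConv G a) := by
  refine ⟨fun p₀ G₀ hp₀ hG hpow hGp => ⟨⟨hG, p₀, hp₀, fun K => ?_⟩, fun a ha => ?_⟩,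
    invOddPart, ⟨isMultiplicative_invOddPart, 2, Nat.prime_two, invOddPart_two_pow⟩,
    fun a ha => ?_, fun a ha => ?_⟩
  · rcases Nat.eq_zero_or_pos K with rfl | hK
    · rw [pow_zero, hG.map_one]
    · exact hpow K hK
  · have ha' := Nat.one_le_iff_ne_zero.mp ha
    exact ⟨ramanujanSeriesTendsto_zero hp₀ hG hGp ha', not_ramanujanSeriesAbsConv hGp ha'⟩
  · exact ramanujanSeriesTendsto_zero Nat.prime_two isMultiplicative_invOddPart
      (fun p hp hp2 => invOddPart_prime hp hp2) (Nat.one_le_iff_ne_zero.mp ha)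
  · exact not_ramanujanSeriesAbsConv (fun p hp hp2 => invOddPart_prime hp hp2)
      (Nat.one_le_iff_ne_zero.mp ha)
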